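/- Let $p=p(n)\in[0,1]$ satisfy $p(n)<\frac{\log^{10} n}{n}$ for all sufficiently large $n$, where $\log$ is the natural logarithm and $\log^{10}n=(\log n)^{10}$. Let $G\sim G(n,p)$ be the binomial random graph on $n$ vertices in which each pair of vertices is an edge independently with probability $p$. Then there is a function $f:\mathbb{N}\to\mathbb{R}$ with $f(n)=o(n)$ such that, with probability tending to $1$ as $n\to\infty$, the following holds simultaneously for all subgraphs $H$ of $G$: if $H$ is an Euler graph (that is, every vertex of $H$ has even degree in $H$; $H$ need not be connected), then the edge set of $H$ can be partitioned into the edge sets of at most $f(n)$ cycles. -/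

import Mathlib

open Filter Topology Asymptotics

namespace CycleDecomposition

open Classical in
/-- An Euler graph: every vertex has even degree (connectedness is not required). -/
def IsEuler {V : Type*} [Fintype V] (H : SimpleGraph V) : Prop :=
  ∀ v : V, Even (H.degree v)

/-- The graph `H` decomposes into exactly `k` cycles: there are `k` cycles of `H` such that
every edge of `H` lies on exactly one of them. -/
def DecomposesIntoCycles {V : Type*} (H : SimpleGraph V) (k : ℕ) : Prop :=
  ∃ (v : Fin k → V) (c : ∀ i : Fin k, H.Walk (v i) (v i)),
    (∀ i, (c i).IsCycle) ∧ ∀ e ∈ H.edgeSet, ∃! i, e ∈ (c i).edges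

end CycleDecomposition

/-!
Write `x = log n`. The argument separates long cycles, which are few because they use many edges,
from short cycles, which are few because a sparse random graph has few of them.

With high probability `G` has fewer than `n x ^ 11` edges, no set of `s ≤ 3L` vertices spanning
`2 s` edges, where `L` is about `x ^ 12`, and fewer than `n / x` cycles of length at most
`log x`. All three are first-moment estimates for one quantity, the number of sets of `s` vertices
with `m` marked edges of `G` among them, whose mean is at most `n ^ s (s ^ 2 p) ^ m`
(`mul_binomialRandom_real_le`); the choices `(s, m) = (2, 1)`, `(s, 2 s)` and `(s, s)` are used.

Let `H` be an Euler subgraph of such a `G`. Removing a cycle keeps a graph Euler, so cycles of length at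
least `L` can be removed greedily (`IsEuler.exists_peeling`); since they are edge-disjoint, there
are at most `n x ^ 11 / L ≤ n / x` of them. In the remaining graph every vertex set `W` contains a
vertex with fewer than 12 neighbours in `W`: otherwise Pósa's rotations of a longest path, together
with the local sparseness of `G`, give another cycle of length at least `L` (`exists_long_cycle`).
So at most `11 n` edges remain (`card_edgesIn_le`), and they decompose into cycles, at most
`11 n / log x` of which are longer than `log x`, while at most `n / x` are not
(`exists_decomposition`). In total there are at most `2 n / x + 11 n / log x = o(n)` cycles.
-/

namespace CycleDecomposition

/-! ### Long cycles by path rotation -/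

section Rotation

variable {V : Type*}

/-- If the endpoint `r` of a path is adjacent to the last vertex of an initial segment with at
least three vertices, that segment closes up to a cycle. -/
theorem exists_isCycle_of_isChain {H : SimpleGraph V} {r w : V} {A : List V}
    (hnd : (r :: (A ++ [w])).Nodup) (hch : (r :: (A ++ [w])).IsChain H.Adj)
    (hadj : H.Adj r w) (hA : A ≠ []) :
    ∃ (u : V) (c : H.Walk u u), c.IsCycle ∧ c.length = A.length + 2 := by
  have hne : r :: (A ++ [w]) ≠ [] := by simp
  obtain ⟨q, hq⟩ : ∃ q : H.Walk r w, q.support = r :: (A ++ [w]) :=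
    ⟨(SimpleGraph.Walk.ofSupport _ hne hch).copy (List.head_cons ..) (by simp),
      (SimpleGraph.Walk.support_copy ..).trans (SimpleGraph.Walk.support_ofSupport ..)⟩
  have hlen : q.length = A.length + 1 := by
    have := q.length_support
    rw [hq] at this
    simp at this
    omega
  have hp : q.IsPath := by rw [SimpleGraph.Walk.isPath_def, hq]; exact hnd
  refine ⟨w, .cons hadj.symm q, ?_, by simp [hlen]⟩
  rw [SimpleGraph.Walk.cons_isCycle_iff]
  refine ⟨hp, fun hmem => ?_⟩
  rw [Sym2.eq_swap] at hmem
  have h1 := hp.eq_snd_of_mem_edges hmem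
  cases q with
  | nil => simp at hlen
  | cons h q' =>
    cases A with
    | nil => exact hA rfl
    | cons a A =>
      simp only [SimpleGraph.Walk.snd_cons] at h1
      subst h1
      have hq' : q'.length = 0 := SimpleGraph.Walk.length_eq_zero_iff.2
        (SimpleGraph.Walk.isPath_iff_nil.1 ((SimpleGraph.Walk.cons_isPath_iff h q').1 hp).1)
      simp at hlen
      omega

/-- Pósa's rotation of a path, written as a list from its movable endpoint `r`: the edge from `r`
to a vertex `x` of the path is added, and the path edge before `x` is dropped. -/
def Rotates (H : SimpleGraph V) (l l' : List V) : Prop :=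
  ∃ (r : V) (A : List V) (x : V) (B : List V), l = (r :: A) ++ x :: B ∧ H.Adj r x ∧
    l' = (r :: A).reverse ++ x :: B

theorem isChain_rotation {S : V → V → Prop} (hS : ∀ a b, S a b → S b a) {r x : V}
    {A B : List V} (h : ((r :: A) ++ x :: B).IsChain S) (hrx : S r x) :
    ((r :: A).reverse ++ x :: B).IsChain S := by
  rw [List.isChain_append] at h ⊢
  refine ⟨?_, h.2.1, ?_⟩
  · rw [List.isChain_reverse]
    exact h.1.imp fun a b => hS a b
  · intro a ha b hb
    simp at ha hb
    subst ha hb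
    exact hrx

/-- Everything that repeated rotation preserves when no cycle has `L` or more vertices: the
rotations then happen within the first `L` vertices of the path. -/
theorem reflTransGen_rotates_invariants {H : SimpleGraph V} {L : ℕ} (hL : 3 ≤ L)
    (hcyc : ∀ (u : V) (c : H.Walk u u), c.IsCycle → c.length < L) {l l' : List V}
    (hnd : l.Nodup) (hch : l.IsChain H.Adj) (h : Relation.ReflTransGen (Rotates H) l l') :
    l'.Perm l ∧ l'.IsChain H.Adj ∧ l'.drop L = l.drop L := by
  induction h with
  | refl => exact ⟨.refl _, hch, rfl⟩
  | tail _ hrot ih =>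
    obtain ⟨r, A, x, B, rfl, hadj, rfl⟩ := hrot
    obtain ⟨hperm, hch', hdrop⟩ := ih
    refine ⟨((List.reverse_perm _).append_right _).trans hperm,
      isChain_rotation (fun _ _ => SimpleGraph.Adj.symm) hch' hadj, ?_⟩
    rw [← hdrop]
    have hlen : (r :: A).length < L := by
      by_cases hA : A = []
      · subst hA; simp; omega
      · have hnd' := hperm.nodup_iff.2 hnd
        have hsub : (r :: (A ++ [x])) <+: (r :: A) ++ x :: B := ⟨B, by simp⟩
        obtain ⟨u, c, hc, hcl⟩ := exists_isCycle_of_isChain (hnd'.sublist hsub.sublist)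
          (hch'.infix hsub.isInfix) hadj hA
        have := hcyc u c hc
        simp
        omega
    rw [List.drop_append, List.drop_append, List.drop_eq_nil_of_le (as := r :: A) hlen.le,
      List.drop_eq_nil_of_le (as := (r :: A).reverse) (by simpa using hlen.le),
      List.length_reverse]

/-- Let `N` relate consecutive vertices of the path `l`, and call a vertex good only if it is neither
an endpoint of a rotation of `l` nor next to such an endpoint on `l`. Each rotation drops and adds
one edge, both meeting the set of these endpoints. So if two vertices are consecutive on a rotated
path and one of them is good, they are consecutive on `l` already. -/
theorem isChain_of_reflTransGen_rotates {H : SimpleGraph V} {N : V → V → Prop}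
    (hN : ∀ a b, N a b → N b a) {l l' : List V} (hl : l.IsChain N)
    {good : V → Prop}
    (hgood : ∀ x, good x → ∀ r m, Relation.ReflTransGen (Rotates H) l (r :: m) → r ≠ x ∧ ¬ N r x)
    (h : Relation.ReflTransGen (Rotates H) l l') :
    l'.IsChain (fun a b => (good a ∨ good b) → N a b) := by
  induction h with
  | refl => exact hl.imp fun a b hab _ => hab
  | @tail m m' hm hrot ih =>
    have hm' := hm.tail hrot
    obtain ⟨r, A, x, B, rfl, hadj, rfl⟩ := hrot
    refine isChain_rotation (fun a b hab h' => hN _ _ (hab h'.symm)) ih ?_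
    rintro (h' | h')
    · exact ((hgood r h' r _ hm).1 rfl).elim
    · -- the predecessor `y` of `x` becomes an endpoint, and by induction it is next to `x` on `l`
      exfalso
      obtain ⟨y, t, ht⟩ : ∃ y t, (r :: A).reverse = y :: t := by
        cases h2 : (r :: A).reverse with
        | nil => simp at h2
        | cons y t => exact ⟨y, t, rfl⟩
      rw [ht] at hm'
      refine (hgood x h' y _ hm').2 ?_
      have h3 := (List.isChain_append.1 ih).2.2 y (by
        rw [← List.head?_reverse, ht]; simp) x (by simp)
      exact h3 (Or.inr h')

/-- The edges of `H` with both ends in `T`. -/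
noncomputable def edgesIn [Fintype V] (H : SimpleGraph V) (T : Finset V) : Finset (Sym2 V) :=
  open Classical in T.sym2.filter (· ∈ H.edgeSet)

theorem mem_edgesIn [Fintype V] {H : SimpleGraph V} {T : Finset V} {a b : V} :
    s(a, b) ∈ edgesIn H T ↔ (a ∈ T ∧ b ∈ T) ∧ H.Adj a b := by
  simp [edgesIn]

open Classical in
theorem sum_card_adj_le [Fintype V] (H : SimpleGraph V) {R T : Finset V} (hRT : R ⊆ T) :
    ∑ r ∈ R, (T.filter (H.Adj r)).card ≤ 2 * (edgesIn H T).card := by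
  rw [← Finset.card_sigma]
  refine Finset.card_le_mul_card_image_of_maps_to (f := fun x : Σ _ : V, V => s(x.1, x.2)) ?_ 2 ?_
  · rintro ⟨a, b⟩ h
    simp only [Finset.mem_sigma, Finset.mem_filter] at h
    exact mem_edgesIn.2 ⟨⟨hRT h.1, h.2.1⟩, h.2.2⟩
  · intro e _
    induction e with
    | _ a b =>
    refine (Finset.card_le_card (t := {⟨a, b⟩, ⟨b, a⟩}) ?_).trans Finset.card_le_two
    rintro ⟨c, d⟩ h
    simp only [Finset.mem_filter, Sym2.eq_iff] at h
    rcases h.2 with ⟨rfl, rfl⟩ | ⟨rfl, rfl⟩ <;> simp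

theorem exists_longest_path [Fintype V] (H : SimpleGraph V) {W : Finset V} (hW : W.Nonempty) :
    ∃ l : List V, l ≠ [] ∧ l.Nodup ∧ l.IsChain H.Adj ∧ (∀ v ∈ l, v ∈ W) ∧
      ∀ l' : List V, l'.Nodup → l'.IsChain H.Adj → (∀ v ∈ l', v ∈ W) → l'.length ≤ l.length := by
  classical
  let P : ℕ → Prop := fun k => ∃ l : List V, l ≠ [] ∧ l.Nodup ∧ l.IsChain H.Adj ∧
    (∀ v ∈ l, v ∈ W) ∧ l.length = k
  obtain ⟨w, hw⟩ := hW
  have hP1 : P 1 := ⟨[w], by simp, by simp, by simp, by simpa using hw, by simp⟩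
  have hbd : ∀ k, P k → k ≤ Fintype.card V := by
    rintro k ⟨l, -, hnd, -, -, rfl⟩
    exact hnd.length_le_card
  obtain ⟨l, h1, h2, h3, h4, h5⟩ := Nat.findGreatest_spec (P := P) (hbd 1 hP1) hP1
  refine ⟨l, h1, h2, h3, h4, fun l' g1 g2 g3 => ?_⟩
  rw [h5]
  rcases eq_or_ne l' [] with rfl | hne
  · simp
  · exact Nat.le_findGreatest g1.length_le_card ⟨l', hne, g1, g2, g3, rfl⟩

open Classical in
/-- Pósa's lemma in a locally sparse graph. Among the endpoints `R` of the rotations of a longest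
path, every neighbour is in `R` or next to `R` on the path; so `R` and its neighbours are at most
`3 * #R` vertices, and they span at least `6 * #R` edges. Without long cycles `R` is small. -/
theorem exists_long_cycle [Fintype V] {H : SimpleGraph V} {L : ℕ} (hL : 3 ≤ L)
    (hsparse : ∀ T : Finset V, T.Nonempty → T.card ≤ 3 * L → (edgesIn H T).card < 2 * T.card)
    {W : Finset V} (hW : W.Nonempty) (hdeg : ∀ v ∈ W, 12 ≤ (W.filter (H.Adj v)).card) :
    ∃ (u : V) (c : H.Walk u u), c.IsCycle ∧ L ≤ c.length := by
  by_contra! hcyc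
  obtain ⟨l, hne, hnd, hch, hlW, hmax⟩ := exists_longest_path H hW
  -- `a` and `b` are neighbours on the path `l`
  let N : V → V → Prop := fun a b => l.idxOf a = l.idxOf b + 1 ∨ l.idxOf b = l.idxOf a + 1
  have hN : ∀ a b, N a b → N b a := fun a b h => h.symm
  have hlN : l.IsChain N := by
    rw [List.isChain_iff_getElem]
    intro i hi
    right
    rw [hnd.idxOf_getElem, hnd.idxOf_getElem]
  have hinv := fun {l'} => reflTransGen_rotates_invariants (l' := l') hL hcyc hnd hch
  let R : Finset V := Finset.univ.filter fun r =>
    ∃ m, Relation.ReflTransGen (Rotates H) l (r :: m)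
  let NR : Finset V := R.biUnion fun r => l.toFinset.filter (N r)
  have hNR : NR.card ≤ R.card * 2 := by
    refine Finset.card_biUnion_le_card_mul _ _ _ fun r _ => ?_
    rw [← Finset.card_image_of_injOn (f := fun b => l.idxOf b)]
    · refine (Finset.card_le_card (t := {l.idxOf r + 1, l.idxOf r - 1}) ?_).trans
        Finset.card_le_two
      intro i hi
      simp only [Finset.mem_image, Finset.mem_filter] at hi
      obtain ⟨b, ⟨-, h | h⟩, rfl⟩ := hi
      · simp; omega
      · simp; omega
    · intro a ha b _ hab
      simp only [Finset.coe_filter, List.mem_toFinset, Set.mem_ofPred_eq] at ha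
      exact (List.idxOf_inj ha.1).1 hab
  have hRne : R.Nonempty := by
    cases l with
    | nil => exact (hne rfl).elim
    | cons r m => exact ⟨r, by simp only [R, Finset.mem_filter, Finset.mem_univ, true_and]
                               exact ⟨m, .refl⟩⟩
  -- the vertices beyond the first `L` never move, so all endpoints are among the first `L`
  have hRL : R.card ≤ L := by
    have hsub : R ⊆ (l.take L).toFinset := by
      intro r hr
      simp only [R, Finset.mem_filter, Finset.mem_univ, true_and] at hr
      obtain ⟨m, hm⟩ := hr
      obtain ⟨hperm, -, hdrop⟩ := hinv hm
      have : ((r :: m).take L).Perm (l.take L) := by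
        rw [← List.perm_append_right_iff ((r :: m).drop L), List.take_append_drop, hdrop,
          List.take_append_drop]
        exact hperm
      rw [List.mem_toFinset, ← this.mem_iff]
      cases L with
      | zero => omega
      | succ L => simp
    exact (Finset.card_le_card hsub).trans ((List.toFinset_card_le _).trans (by simp))
  have hclosed : ∀ r ∈ R, W.filter (H.Adj r) ⊆ (R ∪ NR).filter (H.Adj r) := by
    intro r hr w hw
    rw [Finset.mem_filter] at hw ⊢
    refine ⟨?_, hw.2⟩
    have hr' := hr
    simp only [R, Finset.mem_filter, Finset.mem_univ, true_and] at hr'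
    obtain ⟨m, hm⟩ := hr'
    obtain ⟨hperm, hchm, -⟩ := hinv hm
    have hndm := hperm.nodup_iff.2 hnd
    -- by maximality of the path, all neighbours of its endpoint lie on it
    have hwm : w ∈ r :: m := by
      by_contra hwm
      have := hmax (w :: r :: m) (List.nodup_cons.2 ⟨hwm, hndm⟩)
        (List.isChain_cons_cons.2 ⟨hw.2.symm, hchm⟩) (by
          intro v hv
          rcases List.mem_cons.1 hv with rfl | hv
          · exact hw.1
          · exact hlW v (hperm.mem_iff.1 hv))
      rw [List.length_cons, hperm.length_eq] at this
      omega
    have hwm' : w ∈ m := by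
      rcases List.mem_cons.1 hwm with h | h
      · exact (hw.2.ne h.symm).elim
      · exact h
    obtain ⟨A, B, rfl⟩ := List.append_of_mem hwm'
    -- otherwise `w` is good, while its predecessor `y` on the path is the next endpoint
    by_contra hbad
    have hgood : ∀ x, x = w → ∀ r m, Relation.ReflTransGen (Rotates H) l (r :: m) →
        r ≠ x ∧ ¬ N r x := by
      intro x hx r' m' hm'
      rw [hx]
      have hr'R : r' ∈ R := by
        simp only [R, Finset.mem_filter, Finset.mem_univ, true_and]
        exact ⟨m', hm'⟩
      refine ⟨fun h => hbad (Finset.mem_union_left _ (h ▸ hr'R)), fun h => hbad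
        (Finset.mem_union_right _ ?_)⟩
      refine Finset.mem_biUnion.2 ⟨r', hr'R, ?_⟩
      rw [Finset.mem_filter, List.mem_toFinset]
      exact ⟨hperm.mem_iff.1 hwm, h⟩
    have hm2 : Relation.ReflTransGen (Rotates H) l ((r :: A).reverse ++ w :: B) :=
      hm.tail ⟨r, A, w, B, by simp, hw.2, rfl⟩
    have hS := isChain_of_reflTransGen_rotates hN hlN (good := (· = w)) hgood hm
    rw [← List.cons_append, List.isChain_append] at hS
    obtain ⟨y, t, ht⟩ : ∃ y t, (r :: A).reverse = y :: t := by
      cases h2 : (r :: A).reverse with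
      | nil => simp at h2
      | cons y t => exact ⟨y, t, rfl⟩
    rw [ht] at hm2
    refine (hgood w rfl y _ hm2).2 ?_
    exact hS.2.2 y (by rw [← List.head?_reverse, ht]; simp) w (by simp) (Or.inr rfl)
  have hRW : ∀ r ∈ R, r ∈ W := by
    intro r hr
    simp only [R, Finset.mem_filter, Finset.mem_univ, true_and] at hr
    obtain ⟨m, hm⟩ := hr
    exact hlW r ((hinv hm).1.mem_iff.1 (by simp))
  have hcard := Finset.card_union_le R NR
  have h1 := hsparse (R ∪ NR) (hRne.mono Finset.subset_union_left) (by omega)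
  have h2 := sum_card_adj_le H (Finset.subset_union_left (s₁ := R) (s₂ := NR))
  have h3 : R.card * 12 ≤ ∑ r ∈ R, ((R ∪ NR).filter (H.Adj r)).card := by
    rw [← smul_eq_mul]
    exact Finset.card_nsmul_le_sum _ _ _ fun r hr =>
      (hdeg r (hRW r hr)).trans (Finset.card_le_card (hclosed r hr))
  omega

open Classical in
/-- A locally sparse graph without long cycles is 11-degenerate. -/
theorem card_edgesIn_le [Fintype V] {H : SimpleGraph V} {L : ℕ} (hL : 3 ≤ L)
    (hsparse : ∀ T : Finset V, T.Nonempty → T.card ≤ 3 * L → (edgesIn H T).card < 2 * T.card)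
    (hcyc : ∀ (u : V) (c : H.Walk u u), c.IsCycle → c.length < L) (W : Finset V) :
    (edgesIn H W).card ≤ 11 * W.card := by
  induction W using Finset.strongInduction with
  | H W ih =>
  rcases W.eq_empty_or_nonempty with rfl | hW
  · simp [edgesIn]
  obtain ⟨v, hv, hdeg⟩ : ∃ v ∈ W, (W.filter (H.Adj v)).card < 12 := by
    by_contra! h
    obtain ⟨u, c, hc, hlen⟩ := exists_long_cycle hL hsparse hW h
    exact absurd (hcyc u c hc) (by omega)
  have hsub : edgesIn H W ⊆ edgesIn H (W.erase v) ∪ (W.filter (H.Adj v)).image (s(v, ·)) := by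
    intro e he
    induction e with
    | _ a b =>
    obtain ⟨⟨ha, hb⟩, hab⟩ := mem_edgesIn.1 he
    rw [Finset.mem_union, mem_edgesIn, Finset.mem_image]
    by_cases hav : a = v
    · subst hav
      exact Or.inr ⟨b, by simp [hb, hab], rfl⟩
    by_cases hbv : b = v
    · subst hbv
      exact Or.inr ⟨a, by simp [ha, hab.symm], Sym2.eq_swap⟩
    · exact Or.inl ⟨⟨by simp [ha, hav], by simp [hb, hbv]⟩, hab⟩
  have h1 := (Finset.card_le_card hsub).trans (Finset.card_union_le _ _)
  have h2 := ih _ (Finset.erase_ssubset hv)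
  have h3 := Finset.card_image_le (s := W.filter (H.Adj v)) (f := (s(v, ·)))
  have h4 := Finset.card_erase_add_one hv
  omega

end Rotation

/-! ### Removing cycles from Euler graphs -/

section Peeling

variable {V : Type*}

theorem IsEuler.exists_isCycle [Fintype V] {H : SimpleGraph V} (hH : IsEuler H) (hne : H ≠ ⊥) :
    ∃ (u : V) (c : H.Walk u u), c.IsCycle := by
  classical
  obtain ⟨a, b, hab⟩ := SimpleGraph.ne_bot_iff_exists_adj.1 hne
  obtain ⟨l, -, hnd, hch, -, hmax⟩ := exists_longest_path H (W := Finset.univ) ⟨a, by simp⟩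
  have h2 := hmax [a, b] (by simp [hab.ne]) (by simp [hab]) (by simp)
  match l, h2 with
  | r :: s :: m, _ =>
    have hrs : H.Adj r s := (List.isChain_cons_cons.1 hch).1
    obtain ⟨w, hw, hws⟩ : ∃ w, H.Adj r w ∧ w ≠ s := by
      have h3 : 1 < H.degree r := by
        have h4 : 0 < H.degree r := (H.degree_pos_iff_exists_adj r).2 ⟨s, hrs⟩
        have h5 : Even (H.degree r) := by convert hH r
        obtain ⟨k, hk⟩ := h5
        omega
      rw [← SimpleGraph.card_neighborFinset_eq_degree] at h3
      obtain ⟨w, hw, hws⟩ := Finset.exists_mem_ne h3 s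
      exact ⟨w, by simpa using hw, hws⟩
    have hwl : w ∈ r :: s :: m := by
      by_contra hwl
      have := hmax (w :: r :: s :: m) (List.nodup_cons.2 ⟨hwl, hnd⟩)
        (List.isChain_cons_cons.2 ⟨hw.symm, hch⟩) (by simp)
      simp at this
    have hwm : w ∈ m := by
      simpa [hw.ne', hws] using hwl
    obtain ⟨A, B, rfl⟩ := List.append_of_mem hwm
    have hpre : r :: ((s :: A) ++ [w]) <+: r :: s :: (A ++ w :: B) := ⟨B, by simp⟩
    obtain ⟨u, c, hc, -⟩ := exists_isCycle_of_isChain (hnd.sublist hpre.sublist)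
      (hch.infix hpre.isInfix) hw (by simp)
    exact ⟨u, c, hc⟩

open Classical in
theorem isEuler_iff [Fintype V] {H : SimpleGraph V} :
    IsEuler H ↔ ∀ v, Even (H.edgeFinset.filter (v ∈ ·)).card := by
  refine forall_congr' fun v => ?_
  rw [← SimpleGraph.incidenceFinset_eq_filter, SimpleGraph.card_incidenceFinset_eq_degree]

open Classical in
theorem IsEuler.deleteEdges [Fintype V] {H : SimpleGraph V} (hH : IsEuler H) {u : V}
    {c : H.Walk u u} (hc : c.IsCycle) : IsEuler (H.deleteEdges (c.edges.toFinset : Set (Sym2 V))) := by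
  rw [isEuler_iff] at hH ⊢
  intro v
  have hsub : c.edges.toFinset.filter (v ∈ ·) ⊆ H.edgeFinset.filter (v ∈ ·) := by
    refine Finset.filter_subset_filter _ fun e he => ?_
    rw [SimpleGraph.mem_edgeFinset]
    exact c.edges_subset_edgeSet (List.mem_toFinset.1 he)
  have h1 : Even (c.edges.toFinset.filter (v ∈ ·)).card := by
    have h2 := (hc.isTrail.even_countP_edges_iff v).2 (by simp)
    rw [List.countP_eq_length_filter] at h2
    rw [← List.toFinset_card_of_nodup (hc.isTrail.edges_nodup.filter _)] at h2
    convert h2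
    ext
    simp
  have h3 : Even ((H.edgeFinset.filter (v ∈ ·)).card - (c.edges.toFinset.filter (v ∈ ·)).card) :=
    (hH v).tsub h1
  rw [← Finset.card_sdiff_of_subset hsub] at h3
  convert h3 using 2
  ext e
  simp only [Finset.mem_filter, Finset.mem_sdiff, SimpleGraph.mem_edgeFinset,
    SimpleGraph.edgeSet_deleteEdges, Set.mem_sdiff, Finset.mem_coe]
  tauto

/-- `S` is the edge set of a cycle of `H`. -/
def IsCycleEdges (H : SimpleGraph V) (S : Finset (Sym2 V)) : Prop :=
  ∃ (u : V) (c : H.Walk u u), c.IsCycle ∧ ∀ e, e ∈ S ↔ e ∈ c.edges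

theorem IsCycleEdges.mono {H K : SimpleGraph V} (h : H ≤ K) {S : Finset (Sym2 V)}
    (hS : IsCycleEdges H S) : IsCycleEdges K S := by
  obtain ⟨u, c, hc, he⟩ := hS
  exact ⟨u, c.mapLe h, hc.mapLe h, by simpa [SimpleGraph.Walk.edges_mapLe_eq_edges] using he⟩

theorem IsCycleEdges.subset_edgeSet {H : SimpleGraph V} {S : Finset (Sym2 V)}
    (hS : IsCycleEdges H S) {e : Sym2 V} (he : e ∈ S) : e ∈ H.edgeSet := by
  obtain ⟨u, c, -, h⟩ := hS
  exact c.edges_subset_edgeSet ((h e).1 he)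

theorem IsCycleEdges.card_pos {H : SimpleGraph V} {S : Finset (Sym2 V)}
    (hS : IsCycleEdges H S) : 0 < S.card := by
  classical
  obtain ⟨u, c, hc, h⟩ := hS
  rw [show S = c.edges.toFinset by ext; simp [h],
    List.toFinset_card_of_nodup hc.isTrail.edges_nodup, SimpleGraph.Walk.length_edges]
  have := hc.three_le_length
  omega

/-- A cycle has as many vertices as edges. -/
theorem IsCycleEdges.exists_vertices {H : SimpleGraph V} {S : Finset (Sym2 V)}
    (hS : IsCycleEdges H S) : ∃ T : Finset V, T.card = S.card ∧ S ⊆ T.sym2 := by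
  classical
  obtain ⟨u, c, hc, h⟩ := hS
  refine ⟨c.support.tail.toFinset, ?_, fun e he => ?_⟩
  · rw [show S = c.edges.toFinset by ext; simp [h],
      List.toFinset_card_of_nodup hc.isTrail.edges_nodup, SimpleGraph.Walk.length_edges,
      List.toFinset_card_of_nodup hc.support_nodup]
    simp
  · rw [Finset.mem_sym2_iff]
    intro v hv
    have h1 : v ∈ c.support := SimpleGraph.Walk.mem_support_of_mem_edges ((h e).1 he) hv
    rw [List.mem_toFinset]
    rcases (SimpleGraph.Walk.mem_support_iff c).1 h1 with rfl | h2
    · exact SimpleGraph.Walk.end_mem_tail_support hc.not_nil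
    · exact h2

open Classical in
/-- Greedy removal of cycles with at least `L` edges. -/
theorem IsEuler.exists_peeling [Fintype V] (L : ℕ) (H : SimpleGraph V) (hH : IsEuler H) :
    ∃ (K : SimpleGraph V) (C : Finset (Finset (Sym2 V))), K ≤ H ∧ IsEuler K ∧
      (∀ (u : V) (c : K.Walk u u), c.IsCycle → c.length < L) ∧
      (∀ S ∈ C, IsCycleEdges H S ∧ L ≤ S.card ∧ ∀ e ∈ S, e ∉ K.edgeSet) ∧
      (C : Set (Finset (Sym2 V))).PairwiseDisjoint id ∧
      ∀ e ∈ H.edgeSet, e ∈ K.edgeSet ∨ ∃ S ∈ C, e ∈ S := by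
  induction hm : H.edgeFinset.card using Nat.strong_induction_on generalizing H with
  | _ m ih =>
  by_cases hcyc : ∀ (u : V) (c : H.Walk u u), c.IsCycle → c.length < L
  · exact ⟨H, ∅, le_rfl, hH, hcyc, by simp, by simp, fun e he => Or.inl he⟩
  push Not at hcyc
  obtain ⟨u, c, hc, hL⟩ := hcyc
  set S := c.edges.toFinset with hSdef
  have hS : IsCycleEdges H S := ⟨u, c, hc, by simp [hSdef]⟩
  have hScard : S.card = c.length := by
    rw [hSdef, List.toFinset_card_of_nodup hc.isTrail.edges_nodup, SimpleGraph.Walk.length_edges]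
  have hle : H.deleteEdges (S : Set (Sym2 V)) ≤ H := SimpleGraph.deleteEdges_le _
  have hlt : (H.deleteEdges (S : Set (Sym2 V))).edgeFinset.card < m := by
    rw [← hm]
    refine Finset.card_lt_card (Finset.ssubset_iff_subset_ne.2
      ⟨SimpleGraph.edgeFinset_mono hle, fun heq => ?_⟩)
    obtain ⟨e, he⟩ := Finset.card_pos.1 hS.card_pos
    have h1 : e ∈ H.edgeFinset := SimpleGraph.mem_edgeFinset.2 (hS.subset_edgeSet he)
    rw [← heq, SimpleGraph.mem_edgeFinset, SimpleGraph.edgeSet_deleteEdges] at h1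
    exact h1.2 he
  have hHS : IsEuler (H.deleteEdges (S : Set (Sym2 V))) := hH.deleteEdges hc
  obtain ⟨K, C, hKH, hK, hKc, hC, hdisj, hcov⟩ := ih _ hlt _ hHS (by congr!)
  have hSd : ∀ e ∈ S, e ∉ (H.deleteEdges (S : Set (Sym2 V))).edgeSet := by
    intro e he h
    rw [SimpleGraph.edgeSet_deleteEdges] at h
    exact h.2 he
  refine ⟨K, insert S C, hKH.trans hle, hK, hKc, ?_, ?_, ?_⟩
  · intro S' hS'
    rcases Finset.mem_insert.1 hS' with rfl | hS'
    · exact ⟨hS, hScard ▸ hL, fun e he h => hSd e he (SimpleGraph.edgeSet_mono hKH h)⟩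
    · exact ⟨(hC S' hS').1.mono hle, (hC S' hS').2⟩
  · rw [Finset.coe_insert]
    refine hdisj.insert fun S' hS' _ => Finset.disjoint_left.2 fun e he he' => ?_
    exact hSd e he ((hC S' hS').1.subset_edgeSet he')
  · intro e he
    by_cases heS : e ∈ S
    · exact Or.inr ⟨S, Finset.mem_insert_self .., heS⟩
    · rcases hcov e (by rw [SimpleGraph.edgeSet_deleteEdges]; exact ⟨he, heS⟩) with h | ⟨S', h, h'⟩
      · exact Or.inl h
      · exact Or.inr ⟨S', Finset.mem_insert_of_mem h, h'⟩

theorem decomposesIntoCycles_card {H : SimpleGraph V} {C : Finset (Finset (Sym2 V))}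
    (hC : ∀ S ∈ C, IsCycleEdges H S) (hdisj : (C : Set (Finset (Sym2 V))).PairwiseDisjoint id)
    (hcov : ∀ e ∈ H.edgeSet, ∃ S ∈ C, e ∈ S) : DecomposesIntoCycles H C.card := by
  choose v c hc hce using fun i : Fin C.card => hC (C.equivFin.symm i) (C.equivFin.symm i).2
  refine ⟨v, c, hc, fun e he => ?_⟩
  obtain ⟨S, hS, heS⟩ := hcov e he
  refine ⟨C.equivFin ⟨S, hS⟩, (hce _ e).1 (by simpa using heS), fun j hj => ?_⟩
  have hj' := (hce j e).2 hj
  rw [← Equiv.symm_apply_eq]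
  by_contra hne
  exact Finset.disjoint_left.1 (hdisj (C.equivFin.symm j).2 hS
    (fun h => hne (Subtype.ext h))) hj' heS

open Classical in
theorem card_mul_le_of_pairwiseDisjoint [Fintype V] {H : SimpleGraph V}
    {C : Finset (Finset (Sym2 V))} {L : ℕ} (hC : ∀ S ∈ C, IsCycleEdges H S ∧ L ≤ S.card)
    (hdisj : (C : Set (Finset (Sym2 V))).PairwiseDisjoint id) :
    C.card * L ≤ H.edgeFinset.card := by
  calc C.card * L ≤ ∑ S ∈ C, S.card := by
        rw [← smul_eq_mul]
        exact Finset.card_nsmul_le_sum _ _ _ fun S hS => (hC S hS).2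
    _ = (C.biUnion id).card := (Finset.card_biUnion hdisj).symm
    _ ≤ H.edgeFinset.card := by
        refine Finset.card_le_card fun e he => ?_
        obtain ⟨S, hS, heS⟩ := Finset.mem_biUnion.1 he
        exact SimpleGraph.mem_edgeFinset.2 ((hC S hS).1.subset_edgeSet heS)

end Peeling

/-! ### The deterministic decomposition -/

section Deterministic

variable {V : Type*} [Fintype V]

/-- The pairs of a set `T` of `s` vertices and a set of `m` unordered pairs from `T`. Diagonal pairs
are allowed; they are never edges, so they do not matter for `configurationCount`. -/
def configurations (V : Type*) [Fintype V] (s m : ℕ) : Finset (Σ _ : Finset V, Finset (Sym2 V)) :=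
  (Finset.univ.powersetCard s).sigma fun T => T.sym2.powersetCard m

open Classical in
/-- The number of configurations with `s` vertices and `m` edges all of whose edges lie in `G`. -/
noncomputable def configurationCount (G : SimpleGraph V) (s m : ℕ) : ℕ :=
  ((configurations V s m).filter fun x => (x.2 : Set (Sym2 V)) ⊆ G.edgeSet).card

theorem configurationCount_mono {H G : SimpleGraph V} (h : H ≤ G) (s m : ℕ) :
    configurationCount H s m ≤ configurationCount G s m := by
  classical
  refine Finset.card_le_card fun x hx => ?_
  rw [Finset.mem_filter] at hx ⊢
  exact ⟨hx.1, hx.2.trans (SimpleGraph.edgeSet_mono h)⟩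

open Classical in
theorem card_edgeFinset_le_configurationCount (G : SimpleGraph V) :
    G.edgeFinset.card ≤ configurationCount G 2 1 := by
  refine Finset.card_le_card_of_injOn (fun e => ⟨e.toFinset, {e}⟩) (fun e he => ?_) ?_
  · rw [Finset.mem_coe, SimpleGraph.mem_edgeFinset] at he
    simp only [configurations, Finset.coe_filter, Finset.mem_sigma, Finset.mem_powersetCard,
      Set.mem_ofPred_eq, Finset.coe_singleton, Set.singleton_subset_iff,
      Finset.singleton_subset_iff, Finset.card_singleton, and_true]
    refine ⟨⟨⟨Finset.subset_univ _, Sym2.card_toFinset_of_not_isDiag e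
      (G.not_isDiag_of_mem_edgeSet he)⟩, ?_⟩, he⟩
    rw [Finset.mem_sym2_iff]
    exact fun v hv => Sym2.mem_toFinset.2 hv
  · intro e _ e' _ h
    simpa using (Sigma.ext_iff.1 h).2

/-- If no `m` edges of `G` lie within a set of `#T` vertices, then `T` spans fewer than `m` edges. -/
theorem card_edgesIn_lt_of_configurationCount_eq_zero {G : SimpleGraph V} {T : Finset V}
    {m : ℕ} (h : configurationCount G T.card m = 0) : (edgesIn G T).card < m := by
  classical
  by_contra! hm
  obtain ⟨E, hE, hEm⟩ := Finset.exists_subset_card_eq hm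
  rw [configurationCount, Finset.card_eq_zero] at h
  refine Finset.notMem_empty (⟨T, E⟩ : Σ _ : Finset V, Finset (Sym2 V)) (h ▸ ?_)
  simp only [configurations, Finset.mem_filter, Finset.mem_sigma, Finset.mem_powersetCard]
  refine ⟨⟨⟨Finset.subset_univ _, trivial⟩, fun e he => ?_, hEm⟩, fun e he => ?_⟩
  · exact (Finset.mem_filter.1 (hE he)).1
  · exact (Finset.mem_filter.1 (hE he)).2

/-- A cycle with `s` edges has `s` vertices, so it is a configuration of type `(s, s)`. -/
theorem card_short_cycles_le {G : SimpleGraph V} {C : Finset (Finset (Sym2 V))} {l : ℕ}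
    (hC : ∀ S ∈ C, IsCycleEdges G S ∧ S.card ≤ l) :
    C.card ≤ ∑ s ∈ Finset.Icc 1 l, configurationCount G s s := by
  classical
  rw [Finset.card_eq_sum_card_fiberwise (f := Finset.card) (t := Finset.Icc 1 l)
    (fun S hS => Finset.mem_coe.2 (Finset.mem_Icc.2 ⟨(hC S hS).1.card_pos, (hC S hS).2⟩))]
  refine Finset.sum_le_sum fun s _ => ?_
  choose! T hT hST using fun S (hS : S ∈ C) => (hC S hS).1.exists_vertices
  refine Finset.card_le_card_of_injOn (fun S => ⟨T S, S⟩) (fun S hS => ?_) ?_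
  · obtain ⟨hSC, rfl⟩ := Finset.mem_filter.1 hS
    simp only [configurations, Finset.coe_filter, Finset.mem_sigma, Finset.mem_powersetCard,
      Set.mem_ofPred_eq]
    exact ⟨⟨⟨Finset.subset_univ _, hT S hSC⟩, hST S hSC, trivial⟩,
      fun e he => (hC S hSC).1.subset_edgeSet he⟩
  · intro S _ S' _ h
    simpa using (Sigma.ext_iff.1 h).2

/-- The deterministic part: first all cycles with at least `L` edges are removed, and what is left
has at most `11 * n` edges; of the cycles that decompose it, those with more than `l` edges are
few because the edges are few, and the others because `G` has few short cycles. -/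
theorem exists_decomposition {G : SimpleGraph V} {L l : ℕ} (hL : 3 ≤ L)
    (hsparse : ∀ s ∈ Finset.Icc 1 (3 * L), configurationCount G s (2 * s) = 0)
    {H : SimpleGraph V} (hHG : H ≤ G) (hH : IsEuler H) :
    ∃ a b c : ℕ, a * L ≤ configurationCount G 2 1 ∧ b * (l + 1) ≤ 11 * Fintype.card V ∧
      c ≤ ∑ s ∈ Finset.Icc 1 l, configurationCount G s s ∧
      DecomposesIntoCycles H (a + b + c) := by
  classical
  obtain ⟨K, C, hKH, hK, hKc, hC, hCd, hCcov⟩ := hH.exists_peeling L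
  obtain ⟨F, D, hFK, hF, hFc, hD, hDd, hDcov⟩ := hK.exists_peeling 0
  have hFbot : F = ⊥ := by
    by_contra hne
    obtain ⟨u, c, hc⟩ := hF.exists_isCycle hne
    exact absurd (hFc u c hc) (by omega)
  have hKedges : K.edgeFinset.card ≤ 11 * Fintype.card V := by
    have h1 := card_edgesIn_le (H := K) hL (fun T hT hTL => by
      refine card_edgesIn_lt_of_configurationCount_eq_zero (Nat.eq_zero_of_le_zero ?_)
      rw [← hsparse T.card (Finset.mem_Icc.2 ⟨hT.card_pos, hTL⟩)]
      exact configurationCount_mono (hKH.trans hHG) _ _) hKc Finset.univ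
    rw [Finset.card_univ] at h1
    refine (Finset.card_le_card fun e he => ?_).trans h1
    rw [SimpleGraph.mem_edgeFinset] at he
    simp [edgesIn, he]
  refine ⟨C.card, (D.filter (l < ·.card)).card, (D.filter (¬ l < ·.card)).card, ?_, ?_, ?_, ?_⟩
  · refine (card_mul_le_of_pairwiseDisjoint (fun S hS => ⟨(hC S hS).1, (hC S hS).2.1⟩) hCd).trans
      ((card_edgeFinset_le_configurationCount H).trans (configurationCount_mono hHG _ _))
  · refine (card_mul_le_of_pairwiseDisjoint (H := K) (fun S hS => ?_) (hDd.subset ?_)).trans hKedges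
    · rw [Finset.mem_filter] at hS
      exact ⟨(hD S hS.1).1, hS.2⟩
    · exact Finset.coe_subset.2 (Finset.filter_subset _ _)
  · refine card_short_cycles_le fun S hS => ?_
    rw [Finset.mem_filter] at hS
    exact ⟨(hD S hS.1).1.mono (hKH.trans hHG), not_lt.1 hS.2⟩
  · have hdisj : ∀ S ∈ C, ∀ S' ∈ D, Disjoint S S' := fun S hS S' hS' =>
      Finset.disjoint_left.2 fun e he he' =>
        (hC S hS).2.2 e he ((hD S' hS').1.subset_edgeSet he')
    have hCD : Disjoint C D := by
      refine Finset.disjoint_left.2 fun S hS hS' => ?_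
      have := (hC S hS).1.card_pos
      rw [Finset.card_pos] at this
      exact this.ne_empty (disjoint_self.1 (hdisj S hS S hS'))
    rw [add_assoc, Finset.card_filter_add_card_filter_not, ← Finset.card_union_of_disjoint hCD]
    refine decomposesIntoCycles_card (fun S hS => ?_) ?_ fun e he => ?_
    · rcases Finset.mem_union.1 hS with hS | hS
      · exact (hC S hS).1
      · exact (hD S hS).1.mono hKH
    · rw [Finset.coe_union]
      exact Set.PairwiseDisjoint.union hCd hDd fun S hS S' hS' _ => hdisj S hS S' hS'
    · rcases hCcov e he with h | ⟨S, hS, h⟩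
      · rcases hDcov e h with h | ⟨S, hS, h⟩
        · simp [hFbot] at h
        · exact ⟨S, Finset.mem_union_right _ hS, h⟩
      · exact ⟨S, Finset.mem_union_left _ hS, h⟩

end Deterministic

/-! ### First moments in the binomial random graph -/

section FirstMoment

open MeasureTheory ProbabilityTheory unitInterval

variable {V : Type*} [Fintype V]

theorem measurableSet_simpleGraph (S : Set (SimpleGraph V)) : MeasurableSet S := by
  rw [← Set.preimage_image_eq S SimpleGraph.edgeSet_injective]
  exact SimpleGraph.measurable_edgeSet (Set.Finite.measurableSet (Set.toFinite _))

/-- Equality fails only when `E` contains a diagonal pair, where the left side is zero. -/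
theorem binomialRandom_real_subset_edgeSet_le (p : unitInterval) (E : Finset (Sym2 V)) :
    (SimpleGraph.binomialRandom V p).real {G | (E : Set (Sym2 V)) ⊆ G.edgeSet} ≤
      (p : ℝ) ^ E.card := by
  have h : SimpleGraph.binomialRandom V p {G | (E : Set (Sym2 V)) ⊆ G.edgeSet} ≤
      (toNNReal p : ENNReal) ^ E.card := by
    rw [SimpleGraph.binomialRandom_apply]
    refine (measure_mono (t := (E : Set (Sym2 V)).pi fun _ => {True}) ?_).trans ?_
    · rintro _ ⟨G, hG, rfl⟩ e he
      simpa using hG he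
    · rw [Measure.infinitePi_pi _ (fun _ _ => MeasurableSet.singleton _)]
      refine (Finset.prod_le_prod' (g := fun _ => (toNNReal p : ENNReal)) fun e _ => ?_).trans
        (by simp)
      by_cases he : e.IsDiag <;> simp [he]
  refine (ENNReal.toReal_mono (by simp) h).trans ?_
  simp

theorem card_configurations_le (s m : ℕ) :
    ((configurations V s m).card : ℝ) ≤ (Fintype.card V : ℝ) ^ s * ((s : ℝ) ^ 2) ^ m := by
  have h : (configurations V s m).card ≤ Fintype.card V ^ s * (s ^ 2) ^ m := by
    rw [configurations, Finset.card_sigma]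
    refine (Finset.sum_le_card_nsmul _ _ ((s ^ 2) ^ m) fun T hT => ?_).trans ?_
    · rw [Finset.card_powersetCard, Finset.card_sym2, (Finset.mem_powersetCard.1 hT).2]
      refine (Nat.choose_le_pow _ _).trans (Nat.pow_le_pow_left ?_ m)
      rw [Nat.choose_two_right]
      refine Nat.div_le_of_le_mul ?_
      rcases s with _ | s
      · simp
      · simp only [Nat.add_sub_cancel]
        nlinarith
    · rw [Finset.card_powersetCard, smul_eq_mul, Finset.card_univ]
      exact Nat.mul_le_mul_right _ (Nat.choose_le_pow _ _)
  exact_mod_cast h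

/-- Markov's inequality for a sum of configuration counts. -/
theorem mul_binomialRandom_real_le (p : unitInterval) (F : Finset ℕ) (m : ℕ → ℕ) (t : ℝ) :
    t * (SimpleGraph.binomialRandom V p).real
        {G | t ≤ ((∑ s ∈ F, configurationCount G s (m s) : ℕ) : ℝ)} ≤
      ∑ s ∈ F, (Fintype.card V : ℝ) ^ s * ((s : ℝ) ^ 2 * p) ^ m s := by
  classical
  set μ := SimpleGraph.binomialRandom V p
  have : MeasurableSingletonClass (SimpleGraph V) := ⟨fun G => measurableSet_simpleGraph {G}⟩
  have hint : ∀ f : SimpleGraph V → ℝ, Integrable f μ := fun f => Integrable.of_finite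
  refine (mul_meas_ge_le_integral_of_nonneg (Eventually.of_forall fun G => ?_) (hint _) t).trans ?_
  · exact Nat.cast_nonneg _
  have hcount : ∀ (G : SimpleGraph V) (s : ℕ), (configurationCount G s (m s) : ℝ) =
      ∑ x ∈ configurations V s (m s),
        Set.indicator {G : SimpleGraph V | (x.2 : Set (Sym2 V)) ⊆ G.edgeSet} 1 G := by
    intro G s
    rw [configurationCount, Finset.card_filter, Nat.cast_sum]
    refine Finset.sum_congr rfl fun x _ => ?_
    simp [Set.indicator_apply]
  simp only [Nat.cast_sum, hcount]
  rw [integral_finsetSum _ fun _ _ => hint _]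
  refine Finset.sum_le_sum fun s _ => ?_
  rw [integral_finsetSum _ fun _ _ => hint _, mul_pow, ← mul_assoc]
  refine (Finset.sum_le_card_nsmul _ _ ((p : ℝ) ^ m s) fun x hx => ?_).trans ?_
  · rw [integral_indicator_one (measurableSet_simpleGraph _)]
    refine (binomialRandom_real_subset_edgeSet_le p x.2).trans_eq ?_
    rw [configurations, Finset.mem_sigma, Finset.mem_powersetCard, Finset.mem_powersetCard] at hx
    rw [hx.2.2]
  · rw [nsmul_eq_mul]
    exact mul_le_mul_of_nonneg_right (card_configurations_le s (m s)) (pow_nonneg p.2.1 _)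

end FirstMoment

/-! ### Asymptotics -/

section Asymptotics

theorem tendsto_log_natCast : Tendsto (fun n : ℕ => Real.log n) atTop atTop :=
  Real.tendsto_log_atTop.comp tendsto_natCast_atTop_atTop

theorem isLittleO_cycle_bound :
    (fun n : ℕ => 2 * (n / Real.log n) + 11 * (n / Real.log (Real.log n))) =o[atTop]
      (fun n : ℕ => (n : ℝ)) := by
  have h : ∀ u : ℕ → ℝ, Tendsto u atTop atTop →
      (fun n : ℕ => (n : ℝ) / u n) =o[atTop] (fun n : ℕ => (n : ℝ)) := by
    intro u hu
    have h1 : (fun n : ℕ => (u n)⁻¹) =o[atTop] (fun _ : ℕ => (1 : ℝ)) :=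
      (isLittleO_one_iff ℝ).2 (tendsto_inv_atTop_zero.comp hu)
    simpa [div_eq_mul_inv] using (isBigO_refl (fun n : ℕ => (n : ℝ)) atTop).mul_isLittleO h1
  exact ((h _ tendsto_log_natCast).const_mul_left 2).add
    ((h _ (Real.tendsto_log_atTop.comp tendsto_log_natCast)).const_mul_left 11)

/-- An eventual upper bound, in terms of `x = log n`, for the three exceptional probabilities. -/
theorem tendsto_failure_bound :
    Tendsto (fun n : ℕ => 4 / Real.log n + 6 ^ 5 * (Real.log n ^ 80 / n) +
      Real.log n ^ 2 / Real.exp (Real.log n / 2)) atTop (𝓝 0) := by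
  have h1 : Tendsto (fun x : ℝ => 4 / x + 6 ^ 5 * (x ^ 80 / Real.exp x) +
      x ^ 2 / Real.exp (x / 2)) atTop (𝓝 0) := by
    have a1 : Tendsto (fun x : ℝ => 4 / x) atTop (𝓝 0) := tendsto_const_nhds.div_atTop tendsto_id
    have a2 := (Real.tendsto_pow_mul_exp_neg_atTop_nhds_zero 80).const_mul ((6 : ℝ) ^ 5)
    have a3 := ((Real.tendsto_pow_mul_exp_neg_atTop_nhds_zero 2).comp
      (tendsto_id.atTop_div_const (zero_lt_two' ℝ))).const_mul 4
    have := (a1.add a2).add a3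
    simp only [mul_zero, add_zero] at this
    refine this.congr fun x => ?_
    simp only [Real.exp_neg, Function.comp, id]
    ring
  refine (h1.comp tendsto_log_natCast).congr' ?_
  filter_upwards [eventually_gt_atTop 0] with n hn
  simp only [Function.comp]
  rw [Real.exp_log (by exact_mod_cast hn)]

theorem eventually_log_sq_le :
    ∀ᶠ x : ℝ in atTop, 12 * Real.log x ^ 2 ≤ x / 2 := by
  have h := (Real.isLittleO_pow_log_id_atTop (n := 2)).bound (c := 1 / 24) (by norm_num)
  filter_upwards [h, eventually_ge_atTop 0] with x hx hx0
  simp only [id, norm_pow, Real.norm_eq_abs, sq_abs, abs_of_nonneg hx0] at hx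
  linarith

variable {n : ℕ} {p x : ℝ}

/-- The expected number of sets of `s ≤ M` vertices with `2 s` marked edges, where `x = log n`. -/
theorem sum_dense_le (hn : 0 < (n : ℝ)) (hp0 : 0 ≤ p) (hp : p ≤ x ^ 10 / n) (hx : 1 ≤ x) {M : ℕ}
    (hM : (M : ℝ) ≤ 6 * x ^ 12) (hq : 6 ^ 4 * x ^ 68 ≤ n) :
    ∑ s ∈ Finset.Icc 1 M, (n : ℝ) ^ s * ((s : ℝ) ^ 2 * p) ^ (2 * s) ≤ 6 ^ 5 * (x ^ 80 / n) := by
  have hx0 : 0 < x := by linarith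
  set q : ℝ := 6 ^ 4 * x ^ 68 / n with hqdef
  have hq0 : 0 ≤ q := by positivity
  have hq1 : q ≤ 1 := (div_le_one hn).2 hq
  calc ∑ s ∈ Finset.Icc 1 M, (n : ℝ) ^ s * ((s : ℝ) ^ 2 * p) ^ (2 * s)
      ≤ ∑ s ∈ Finset.Icc 1 M, q := by
        refine Finset.sum_le_sum fun s hs => ?_
        rw [Finset.mem_Icc] at hs
        have hsM : (s : ℝ) ≤ 6 * x ^ 12 := le_trans (by exact_mod_cast hs.2) hM
        rw [pow_mul, ← mul_pow]
        have hle : (n : ℝ) * ((s : ℝ) ^ 2 * p) ^ 2 ≤ q := by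
          calc (n : ℝ) * ((s : ℝ) ^ 2 * p) ^ 2
              ≤ n * ((6 * x ^ 12) ^ 2 * (x ^ 10 / n)) ^ 2 := by gcongr
            _ = q := by rw [hqdef]; field_simp
        exact (pow_le_pow_left₀ (by positivity) hle s).trans
          (pow_le_of_le_one hq0 hq1 (by omega))
    _ = M * q := by simp
    _ ≤ 6 * x ^ 12 * q := by gcongr
    _ = 6 ^ 5 * (x ^ 80 / n) := by rw [hqdef]; ring

/-- The expected number of sets of `s ≤ l` vertices with `s` marked edges, where `x = log n`: each
summand is at most `(x ^ 12) ^ l ≤ exp (12 (log x) ^ 2)`. -/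
theorem sum_short_le (hn : 0 < (n : ℝ)) (hp0 : 0 ≤ p) (hp : p ≤ x ^ 10 / n) (hx : 1 ≤ x) {l : ℕ}
    (hl : (l : ℝ) ≤ Real.log x) (hlog : 12 * Real.log x ^ 2 ≤ x / 2) :
    ∑ s ∈ Finset.Icc 1 l, (n : ℝ) ^ s * ((s : ℝ) ^ 2 * p) ^ s ≤ x * Real.exp (x / 2) := by
  have hx0 : 0 < x := by linarith
  have hlx : (l : ℝ) ≤ x := hl.trans ((Real.log_le_sub_one_of_pos hx0).trans (by linarith))
  calc ∑ s ∈ Finset.Icc 1 l, (n : ℝ) ^ s * ((s : ℝ) ^ 2 * p) ^ s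
      ≤ ∑ s ∈ Finset.Icc 1 l, Real.exp (x / 2) := by
        refine Finset.sum_le_sum fun s hs => ?_
        rw [Finset.mem_Icc] at hs
        have hsl : (s : ℝ) ≤ l := by exact_mod_cast hs.2
        rw [← mul_pow]
        have hle : (n : ℝ) * ((s : ℝ) ^ 2 * p) ≤ Real.exp (12 * Real.log x) := by
          calc (n : ℝ) * ((s : ℝ) ^ 2 * p) ≤ n * (x ^ 2 * (x ^ 10 / n)) := by
                gcongr; exact hsl.trans hlx
            _ = x ^ 12 := by field_simp
            _ = Real.exp (12 * Real.log x) := by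
                rw [← Real.exp_log (pow_pos hx0 12), Real.log_pow]; norm_num
        refine (pow_le_pow_left₀ (by positivity) hle s).trans ?_
        rw [← Real.exp_nat_mul, Real.exp_le_exp]
        have hlog0 := Real.log_nonneg hx
        nlinarith [mul_le_mul_of_nonneg_right (hsl.trans hl) hlog0]
    _ = l * Real.exp (x / 2) := by simp
    _ ≤ x * Real.exp (x / 2) := by gcongr

/-- The property of the theorem, with the explicit bound `2 n / log n + 11 n / log log n`. -/
def IsWellDecomposable (n : ℕ) (G : SimpleGraph (Fin n)) : Prop :=
  ∀ H : SimpleGraph (Fin n), H ≤ G → IsEuler H →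
    ∃ k : ℕ, (k : ℝ) ≤ 2 * (n / Real.log n) + 11 * (n / Real.log (Real.log n)) ∧
      DecomposesIntoCycles H k

theorem isWellDecomposable_of_counts {G : SimpleGraph (Fin n)} {L l : ℕ} (hx : x = Real.log n)
    (hx1 : 1 < x) (hL3 : 3 ≤ L) (hL : x ^ 12 ≤ L) (hl : Real.log x ≤ l + 1)
    (hA : (configurationCount G 2 1 : ℝ) < n * x ^ 11)
    (hB : ∑ s ∈ Finset.Icc 1 (3 * L), configurationCount G s (2 * s) < 1)
    (hC : ((∑ s ∈ Finset.Icc 1 l, configurationCount G s s : ℕ) : ℝ) < n / x) :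
    IsWellDecomposable n G := by
  intro H hHG hH
  have hsparse : ∀ s ∈ Finset.Icc 1 (3 * L), configurationCount G s (2 * s) = 0 :=
    Finset.sum_eq_zero_iff.1 (Nat.lt_one_iff.1 hB)
  obtain ⟨a, b, c, ha, hb, hc, hdec⟩ := exists_decomposition (l := l) hL3 hsparse hHG hH
  refine ⟨a + b + c, ?_, hdec⟩
  have hx0 : 0 < x := by linarith
  have hlog : 0 < Real.log x := Real.log_pos hx1
  rw [← hx]
  have ha' : (a : ℝ) ≤ n / x := by
    rw [le_div_iff₀ hx0]
    have h1 : (a : ℝ) * L ≤ configurationCount G 2 1 := by exact_mod_cast ha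
    have h2 : (a : ℝ) * x ^ 12 ≤ a * L := by gcongr
    have h3 : (a * x) * x ^ 11 ≤ n * x ^ 11 := by
      calc (a * x) * x ^ 11 = a * x ^ 12 := by ring
        _ ≤ n * x ^ 11 := by linarith
    exact le_of_mul_le_mul_right h3 (by positivity)
  have hb' : (b : ℝ) ≤ 11 * (n / Real.log x) := by
    rw [← mul_div_assoc, le_div_iff₀ hlog]
    have h1 : (b : ℝ) * (l + 1) ≤ 11 * n := by
      rw [Fintype.card_fin] at hb
      exact_mod_cast hb
    exact (mul_le_mul_of_nonneg_left hl (Nat.cast_nonneg b)).trans h1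
  have hc' : (c : ℝ) ≤ n / x := le_trans (by exact_mod_cast hc) hC.le
  push_cast
  linarith

open MeasureTheory in
/-- A union bound over the three exceptional events: too many edges, a small dense set, too many
short cycles. -/
theorem eventually_binomialRandom_ge (p : ℕ → unitInterval)
    (hp : ∀ᶠ n : ℕ in atTop, (p n : ℝ) < Real.log n ^ 10 / n) :
    ∀ᶠ n : ℕ in atTop, 1 - (4 / Real.log n + 6 ^ 5 * (Real.log n ^ 80 / n) +
        Real.log n ^ 2 / Real.exp (Real.log n / 2)) ≤
      (SimpleGraph.binomialRandom (Fin n) (p n)).real {G | IsWellDecomposable n G} := by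
  have hpoly : ∀ᶠ n : ℕ in atTop, 6 ^ 4 * Real.log n ^ 68 ≤ n := by
    have h := (Real.isLittleO_pow_log_id_atTop (n := 68)).bound (c := 1 / 6 ^ 4) (by norm_num)
    filter_upwards [tendsto_natCast_atTop_atTop.eventually h] with n hn
    simp only [id, Real.norm_eq_abs, Nat.abs_cast] at hn
    have := (le_abs_self _).trans hn
    linarith
  filter_upwards [hp, hpoly, tendsto_log_natCast.eventually eventually_log_sq_le,
    tendsto_log_natCast.eventually_ge_atTop 3, eventually_gt_atTop 0] with n hpn hpoly hlog hx3 hn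
  have hn' : (0 : ℝ) < n := by exact_mod_cast hn
  set x := Real.log n with hx
  set μ := SimpleGraph.binomialRandom (Fin n) (p n)
  have hx0 : 0 < x := by linarith
  have hp0 : (0 : ℝ) ≤ p n := (p n).2.1
  set L := ⌈x ^ 12⌉₊
  set l := ⌊Real.log x⌋₊
  have hLle : x ^ 12 ≤ L := Nat.le_ceil _
  have hx12 : 3 ≤ x ^ 12 := hx3.trans (le_self_pow₀ (by linarith) (by norm_num))
  have hL3 : 3 ≤ L := by exact_mod_cast hx12.trans hLle
  have hM : ((3 * L : ℕ) : ℝ) ≤ 6 * x ^ 12 := by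
    have := Nat.ceil_lt_add_one (pow_nonneg hx0.le 12)
    push_cast
    linarith
  set A : Set (SimpleGraph (Fin n)) :=
    {G | n * x ^ 11 ≤ ((∑ s ∈ ({2} : Finset ℕ), configurationCount G s 1 : ℕ) : ℝ)} with hA
  set B : Set (SimpleGraph (Fin n)) :=
    {G | (1 : ℝ) ≤ ((∑ s ∈ Finset.Icc 1 (3 * L), configurationCount G s (2 * s) : ℕ) : ℝ)} with hB
  set C : Set (SimpleGraph (Fin n)) :=
    {G | n / x ≤ ((∑ s ∈ Finset.Icc 1 l, configurationCount G s s : ℕ) : ℝ)} with hC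
  have hμA : μ.real A ≤ 4 / x := by
    have h := mul_binomialRandom_real_le (V := Fin n) (p n) {2} (fun _ => 1) (n * x ^ 11)
    rw [Finset.sum_singleton, Fintype.card_fin, pow_one, Nat.cast_ofNat] at h
    have h2 : (n : ℝ) ^ 2 * (2 ^ 2 * p n) ≤ n ^ 2 * (2 ^ 2 * (x ^ 10 / n)) := by gcongr
    have h3 : (n : ℝ) ^ 2 * (2 ^ 2 * (x ^ 10 / n)) = n * x ^ 11 * (4 / x) := by
      field_simp; norm_num
    exact le_of_mul_le_mul_left ((h.trans h2).trans_eq h3) (by positivity)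
  have hμB : μ.real B ≤ 6 ^ 5 * (x ^ 80 / n) := by
    have h := mul_binomialRandom_real_le (V := Fin n) (p n) (Finset.Icc 1 (3 * L))
      (fun s => 2 * s) 1
    rw [one_mul, Fintype.card_fin] at h
    exact h.trans (sum_dense_le hn' hp0 hpn.le (by linarith) hM hpoly)
  have hμC : μ.real C ≤ x ^ 2 / Real.exp (x / 2) := by
    have h := mul_binomialRandom_real_le (V := Fin n) (p n) (Finset.Icc 1 l) (fun s => s) (n / x)
    rw [Fintype.card_fin] at h
    have h2 := h.trans (sum_short_le hn' hp0 hpn.le (by linarith)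
      (Nat.floor_le (Real.log_nonneg (by linarith))) hlog)
    refine le_of_mul_le_mul_left (h2.trans_eq ?_) (div_pos hn' hx0)
    have hnx : (n : ℝ) = Real.exp (x / 2) * Real.exp (x / 2) := by
      rw [← Real.exp_add, add_halves, hx, Real.exp_log hn']
    rw [hnx]
    field_simp
  have hsub : (A ∪ B ∪ C)ᶜ ⊆ {G | IsWellDecomposable n G} := by
    intro G hG
    simp only [Set.compl_union, Set.mem_inter_iff, Set.mem_compl_iff, hA, hB, hC,
      Set.mem_ofPred_eq, not_le, Finset.sum_singleton] at hG
    exact isWellDecomposable_of_counts hx (by linarith) hL3 hLle (Nat.lt_floor_add_one _).le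
      hG.1.1 (by exact_mod_cast hG.1.2) hG.2
  have h1 := measureReal_mono (μ := μ) hsub
  rw [probReal_compl_eq_one_sub (measurableSet_simpleGraph _)] at h1
  have h2 := measureReal_union_le (μ := μ) (A ∪ B) C
  have h3 := measureReal_union_le (μ := μ) A B
  linarith

end Asymptotics

end CycleDecomposition

theorem mainTheorem10 (p : ℕ → unitInterval)
    (hp : ∀ᶠ n : ℕ in atTop, (p n : ℝ) < Real.log n ^ 10 / n) :
    ∃ f : ℕ → ℝ, f =o[atTop] (fun n : ℕ => (n : ℝ)) ∧
      Tendsto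
        (fun n : ℕ => SimpleGraph.binomialRandom (Fin n) (p n)
          {G : SimpleGraph (Fin n) | ∀ H : SimpleGraph (Fin n), H ≤ G →
            CycleDecomposition.IsEuler H →
            ∃ k : ℕ, (k : ℝ) ≤ f n ∧ CycleDecomposition.DecomposesIntoCycles H k})
        atTop (𝓝 1) := by
  refine ⟨_, CycleDecomposition.isLittleO_cycle_bound, ?_⟩
  rw [← ENNReal.tendsto_toReal_iff (fun n => MeasureTheory.measure_ne_top _ _) ENNReal.one_ne_top,
    ENNReal.toReal_one]
  have h := CycleDecomposition.tendsto_failure_bound.const_sub 1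
  rw [sub_zero] at h
  exact tendsto_of_tendsto_of_tendsto_of_le_of_le' h tendsto_const_nhds
    (CycleDecomposition.eventually_binomialRandom_ge p hp)
    (Eventually.of_forall fun n => MeasureTheory.measureReal_le_one)
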